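/- Let $a,b\in\mathbb C$, $0<\lambda<\infty$, $0<\theta<\pi$ with $\lambda\theta<2\pi$, and $\mu<1$. All logarithms, arguments and powers are principal. Let $f$ be an entire function such that, as $|z|\to\infty$, \[ f(z)=\begin{cases} z^a(\log z)^b\exp(z^\lambda)\,[1+o(1)] & \text{for } |\arg z|\le\theta,\\ O\!\left(\exp(\mu|z|^\lambda)\right) & \text{for } |\arg z|>\theta,\end{cases} \] each estimate holding uniformly in its sector. Put \[ p_n(z)=\sum_{k=0}^n\frac{f^{(k)}(0)}{k!}z^k,\qquad r_n=\left(\frac n\lambda\right)^{1/\lambda},\qquad S=\left\{z\in\mathbb C:\ \left|z^\lambda\exp(1-z^\lambda)\right|=1,\ |z|\le 1\right\}. \] Let $\xi\in S$ with $|\arg\xi|<\theta$ and $\xi\ne1$, let $\tau=\operatorname{Im}(\xi^\lambda-1-\lambda\log\xi)$, and define $\tau_n$ by \[ \frac{\tau n}{\lambda}\equiv\tau_n \pmod{2\pi},\qquad -\pi<\tau_n\le\pi . \] Let \[ z_n(w)=\xi\left(1+\frac{\log n}{2(1-\xi^\lambda)n}-\frac{w-i\tau_n}{(1-\xi^\lambda)n}\right).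 \] Then \[ \lim_{n\to\infty}\frac{p_{n-1}(r_nz_n(w))}{f(r_nz_n(w))}=1-\frac{e^{-w}}{\xi^a(1-\xi)\sqrt{2\pi\lambda}} \] uniformly for $w$ in any compact subset of $\mathbb C$. -/

import Mathlib

open Filter Topology Asymptotics

/-- Growth condition with a single sector `|arg z| ≤ θ` of maximal growth: as `|z| → ∞`,
`f z = z ^ a * (log z) ^ b * exp (z ^ lam) * (1 + o(1))` uniformly for `|arg z| ≤ θ`, and
`f z = O(exp (mu * |z| ^ lam))` uniformly for `|arg z| > θ`. All powers, logarithms and arguments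
are principal. -/
structure HasSectorGrowth (f : ℂ → ℂ) (a b : ℂ) (lam θ mu : ℝ) : Prop where
  equiv_in_sector :
    f ~[Bornology.cobounded ℂ ⊓ 𝓟 {z : ℂ | |z.arg| ≤ θ}]
      fun z => z ^ a * Complex.log z ^ b * Complex.exp (z ^ (lam : ℂ))
  bigO_off_sector :
    f =O[Bornology.cobounded ℂ ⊓ 𝓟 {z : ℂ | θ < |z.arg|}]
      fun z => Real.exp (mu * ‖z‖ ^ lam)

/-- The Maclaurin partial sum `p_n(z) = ∑_{k=0}^n f^{(k)}(0) / k! * z^k`. -/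
noncomputable def maclaurinSum (f : ℂ → ℂ) (n : ℕ) (z : ℂ) : ℂ :=
  ∑ k ∈ Finset.range (n + 1), iteratedDeriv k f 0 / (k.factorial : ℂ) * z ^ k

/-- The scaling radius `r_n = (n / lam) ^ (1 / lam)`. -/
noncomputable def scaleRadius (lam : ℝ) (n : ℕ) : ℝ :=
  ((n : ℝ) / lam) ^ (1 / lam)

/-- The curve `S = {z : |z ^ lam * exp (1 - z ^ lam)| = 1, |z| ≤ 1}`. -/
def limitCurve (lam : ℝ) : Set ℂ :=
  {z : ℂ | ‖z ^ (lam : ℂ) * Complex.exp (1 - z ^ (lam : ℂ))‖ = 1 ∧ ‖z‖ ≤ 1}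

/-- `τ = Im (ξ ^ lam - 1 - lam * log ξ)`. -/
noncomputable def phaseTau (lam : ℝ) (ξ : ℂ) : ℝ :=
  (ξ ^ (lam : ℂ) - 1 - (lam : ℂ) * Complex.log ξ).im

/-- The representative `τ_n ∈ (-π, π]` of `τ * n / lam` modulo `2π`. -/
noncomputable def phaseTauSeq (lam : ℝ) (ξ : ℂ) (n : ℕ) : ℝ :=
  toIocMod Real.two_pi_pos (-Real.pi) (phaseTau lam ξ * n / lam)

/-- `phaseTauSeq` is characterised by the congruence and the range it is meant to satisfy. -/
theorem phaseTauSeq_eq_iff (lam : ℝ) (ξ : ℂ) (n : ℕ) (t : ℝ) :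
    phaseTauSeq lam ξ n = t ↔
      (-Real.pi < t ∧ t ≤ Real.pi) ∧
        ∃ k : ℤ, phaseTau lam ξ * n / lam = t + k * (2 * Real.pi) := by
  rw [phaseTauSeq, toIocMod_eq_iff]
  have h : -Real.pi + 2 * Real.pi = Real.pi := by ring
  simp only [Set.mem_Ioc, h, zsmul_eq_mul]

/-- `z_n(w) = ξ (1 + log n / (2 (1 - ξ ^ lam) n) - (w - i τ_n) / ((1 - ξ ^ lam) n))`. -/
noncomputable def arcPoint (lam : ℝ) (ξ : ℂ) (n : ℕ) (w : ℂ) : ℂ :=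
  ξ * (1 + (Real.log n : ℂ) / (2 * (1 - ξ ^ (lam : ℂ)) * n)
    - (w - Complex.I * (phaseTauSeq lam ξ n : ℂ)) / ((1 - ξ ^ (lam : ℂ)) * n))

/-! The remainder of the Taylor polynomial is a Cauchy integral over the circle of radius `r_n`.
With `z = r_n ζ` and `s = r_n e^{it}` it equals `ζ^n / 2π` times the integral of `f(r_n e^{it})
e^{-int}` against the kernel `e^{it} / (e^{it} - ζ)`. Write `A_n` for the size of the comparison
function at `r_n` (`growthScale`). The choice `r_n^λ = n/λ` puts a saddle point at `t = 0`: near it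
the integrand, without the kernel, is about `A_n exp(-λ n t² / 2)`. Laplace's method gives the
integral as `A_n √(2π/(λn)) / (1 - ξ)` to leading order when `ζ → ξ` and `|ξ| < 1`
(`HasSectorGrowth.tendsto_sqrt_mul_integral`).

The growth condition at `r_n ζ` gives `f(r_n ζ) ~ A_n ξ^a exp((n/λ)(ζ^λ - 1))`
(`HasSectorGrowth.tendsto_div`). In the quotient `A_n` cancels, and what remains to control is `ζ^n
exp(-(n/λ)(ζ^λ - 1)) / √n`. This is `exp(n φ(ζ)) / √n` with `φ = saddlePhase`. On the limit curve
`φ(ξ)` is purely imaginary, and the points `z_n(w)` are those for which linearising `φ` at `ξ` turns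
this expression into `e^{-w}` (`tendsto_arcPoint_pow_mul_exp`).

Uniformity on `K` is obtained by proving every limit along the filter `atTop ×ˢ 𝓟 K`; hence the
auxiliary limits are stated for general filters. -/

/-! ### Integral formula for the Taylor remainder. -/

/-- Cauchy's formulas for the value and the coefficients, subtracted: the finite geometric sum in `z
/ s` leaves only its tail. The condition `n ≠ 0` avoids the truncated subtraction `0 - 1 = 0`. -/
theorem sub_maclaurinSum_eq_circleIntegral {f : ℂ → ℂ} (hf : Differentiable ℂ f) {r : ℝ}
    (hr : 0 < r) {z : ℂ} (hz : ‖z‖ < r) {n : ℕ} (hn : n ≠ 0) :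
    f z - maclaurinSum f (n - 1) z =
      (2 * Real.pi * Complex.I)⁻¹ * ∮ s in C(0, r), f s * (z / s) ^ n / (s - z) := by
  have hs0 : ∀ s ∈ Metric.sphere (0 : ℂ) r, s ≠ 0 ∧ s - z ≠ 0 := by
    intro s hs
    rw [mem_sphere_zero_iff_norm] at hs
    refine ⟨fun h => ?_, fun h => ?_⟩
    · rw [h, norm_zero] at hs; exact hr.ne hs
    · rw [sub_eq_zero] at h; rw [h] at hs; exact hz.ne hs
  have hpi : (2 * Real.pi * Complex.I : ℂ) ≠ 0 := Complex.two_pi_I_ne_zero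
  have hcoef : ∀ k : ℕ, iteratedDeriv k f 0 / (k.factorial : ℂ) * z ^ k =
      (2 * Real.pi * Complex.I)⁻¹ * ∮ s in C(0, r), z ^ k * ((1 / s ^ (k + 1)) * f s) := by
    intro k
    have h := (hf.differentiableOn (s := Metric.closedBall (0 : ℂ) r)
      ).circleIntegral_one_div_sub_center_pow_smul hr k
    simp only [sub_zero, smul_eq_mul] at h
    rw [circleIntegral.integral_const_mul, h]
    field_simp
  have hmain := (hf.differentiableOn (s := Metric.closedBall (0 : ℂ) r)
    ).circleIntegral_sub_inv_smul (w := z) (by simpa using hz)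
  simp only [smul_eq_mul] at hmain
  have hfz : f z = (2 * Real.pi * Complex.I)⁻¹ * ∮ s in C(0, r), (s - z)⁻¹ * f s := by
    rw [hmain]; field_simp
  have hint : ∀ k, CircleIntegrable (fun s => z ^ k * ((1 / s ^ (k + 1)) * f s)) 0 r := by
    intro k
    refine ContinuousOn.circleIntegrable hr.le ?_
    refine continuousOn_const.mul (ContinuousOn.mul ?_ hf.continuous.continuousOn)
    exact continuousOn_const.div (by fun_prop) fun s hs => pow_ne_zero _ (hs0 s hs).1
  have hint' : CircleIntegrable (fun s => (s - z)⁻¹ * f s) 0 r := by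
    refine ContinuousOn.circleIntegrable hr.le ?_
    exact ContinuousOn.mul (ContinuousOn.inv₀ (by fun_prop) fun s hs => (hs0 s hs).2)
      hf.continuous.continuousOn
  rw [maclaurinSum, Nat.sub_add_cancel (Nat.one_le_iff_ne_zero.2 hn), hfz,
    Finset.sum_congr rfl fun k _ => hcoef k, ← Finset.mul_sum, ← mul_sub,
    ← circleIntegral.integral_fun_sum fun k _ => hint k,
    ← circleIntegral.integral_sub hint' (CircleIntegrable.fun_sum _ fun k _ => hint k)]
  congr 1
  refine circleIntegral.integral_congr hr.le fun s hs => ?_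
  obtain ⟨h0, h1⟩ := hs0 s hs
  have hsum : ∑ k ∈ Finset.range n, z ^ k * ((1 / s ^ (k + 1)) * f s) =
      f s / s * ∑ k ∈ Finset.range n, (z / s) ^ k := by
    rw [Finset.mul_sum]
    refine Finset.sum_congr rfl fun k _ => ?_
    rw [div_pow, pow_succ]
    field_simp
  have hne : z / s ≠ 1 := by
    rw [Ne, div_eq_one_iff_eq h0]
    exact fun h => h1 (by rw [h, sub_self])
  have h2 : z / s - 1 ≠ 0 := sub_ne_zero.2 hne
  have h3 : z - s ≠ 0 := by rw [← neg_sub]; exact neg_ne_zero.2 h1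
  simp only [hsum, geom_sum_eq hne]
  have : z / s - 1 = -(s - z) / s := by field_simp; ring
  rw [this]
  field_simp
  ring

theorem sub_maclaurinSum_eq_integral {f : ℂ → ℂ} (hf : Differentiable ℂ f) {r : ℝ}
    (hr : 0 < r) {ζ : ℂ} (hζ : ‖ζ‖ < 1) {n : ℕ} (hn : n ≠ 0) :
    f (r * ζ) - maclaurinSum f (n - 1) (r * ζ) =
      ζ ^ n / (2 * Real.pi) * ∫ t in Set.Ioc (-Real.pi) Real.pi,
        f (r * Complex.exp (t * Complex.I)) * Complex.exp (-(n * t * Complex.I)) *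
          (Complex.exp (t * Complex.I) / (Complex.exp (t * Complex.I) - ζ)) := by
  have hz : ‖(r : ℂ) * ζ‖ < r := by
    rw [norm_mul, Complex.norm_of_nonneg hr.le]
    exact mul_lt_of_lt_one_right hr hζ
  have hpi : (2 * Real.pi * Complex.I : ℂ) ≠ 0 := Complex.two_pi_I_ne_zero
  have hpi' : (Real.pi : ℂ) ≠ 0 := by exact_mod_cast Real.pi_ne_zero
  have hrc : (r : ℂ) ≠ 0 := by exact_mod_cast hr.ne'
  rw [sub_maclaurinSum_eq_circleIntegral hf hr hz hn, circleIntegral]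
  have hcm : ∀ t : ℝ, circleMap 0 r t = r * Complex.exp (t * Complex.I) := fun t => by
    simp [circleMap]
  have hpt : ∀ t : ℝ, deriv (circleMap 0 r) t • (f (circleMap 0 r t) *
      (r * ζ / circleMap 0 r t) ^ n / (circleMap 0 r t - r * ζ)) =
      (Complex.I * ζ ^ n) *
      (f (r * Complex.exp (t * Complex.I)) * Complex.exp (-(n * t * Complex.I)) *
          (Complex.exp (t * Complex.I) / (Complex.exp (t * Complex.I) - ζ))) := by
    intro t
    have he : Complex.exp (t * Complex.I) ≠ 0 := Complex.exp_ne_zero _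
    have hd : Complex.exp (t * Complex.I) - ζ ≠ 0 := by
      intro h
      rw [sub_eq_zero] at h
      rw [← h, Complex.norm_exp_ofReal_mul_I] at hζ
      exact lt_irrefl _ hζ
    have hexp : Complex.exp (-(n * t * Complex.I)) = (Complex.exp (t * Complex.I) ^ n)⁻¹ := by
      rw [Complex.exp_neg, ← Complex.exp_nat_mul, mul_assoc]
    rw [deriv_circleMap, hcm, hexp, ← mul_sub, mul_div_mul_left _ _ hrc, div_pow, smul_eq_mul]
    field_simp
  have hper : Function.Periodic (fun t : ℝ => deriv (circleMap 0 r) t • (f (circleMap 0 r t) *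
      (r * ζ / circleMap 0 r t) ^ n / (circleMap 0 r t - r * ζ))) (2 * Real.pi) := by
    intro t
    simp only [deriv_circleMap, periodic_circleMap 0 r t]
  -- The window moves from `[0, 2π]` to `(-π, π]`, where `t` is the principal argument of `e^{it}`.
  have hshift := hper.intervalIntegral_add_eq 0 (-Real.pi)
  rw [zero_add, show -Real.pi + 2 * Real.pi = Real.pi by ring] at hshift
  rw [hshift, ← intervalIntegral.integral_of_le (by linarith [Real.pi_pos])]
  simp only [hpt]
  rw [intervalIntegral.integral_const_mul, ← mul_assoc]
  congr 1
  field_simp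

/-! ### The growth condition at scale `r_n`. -/

theorem Complex.ofReal_mul_cpow {x : ℝ} (hx : 0 < x) {y : ℂ} (hy : y ≠ 0) (b : ℂ) :
    ((x : ℂ) * y) ^ b = (x : ℂ) ^ b * y ^ b := by
  have hxc : (x : ℂ) ≠ 0 := by exact_mod_cast hx.ne'
  rw [Complex.cpow_def_of_ne_zero (mul_ne_zero hxc hy), Complex.cpow_def_of_ne_zero hxc,
    Complex.cpow_def_of_ne_zero hy, Complex.log_ofReal_mul hx hy, ← Complex.exp_add,
    Complex.ofReal_log hx.le, add_mul]

theorem scaleRadius_pos {lam : ℝ} (hlam : 0 < lam) {n : ℕ} (hn : n ≠ 0) :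
    0 < scaleRadius lam n :=
  Real.rpow_pos_of_pos (div_pos (by positivity) hlam) _

theorem scaleRadius_rpow {lam : ℝ} (hlam : 0 < lam) (n : ℕ) :
    scaleRadius lam n ^ lam = n / lam := by
  rw [scaleRadius, ← Real.rpow_mul (by positivity), one_div_mul_cancel hlam.ne', Real.rpow_one]

theorem tendsto_scaleRadius {lam : ℝ} (hlam : 0 < lam) :
    Tendsto (scaleRadius lam) atTop atTop :=
  (tendsto_rpow_atTop (one_div_pos.2 hlam)).comp
    (tendsto_natCast_atTop_atTop.atTop_div_const hlam)

/-- The size of the growth comparison function on the positive axis at `r_n`. -/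
noncomputable def growthScale (a b : ℂ) (lam : ℝ) (n : ℕ) : ℂ :=
  (scaleRadius lam n : ℂ) ^ a * (Real.log (scaleRadius lam n) : ℂ) ^ b * Complex.exp (n / lam)

theorem growthScale_ne_zero {a b : ℂ} {lam : ℝ} (hlam : 0 < lam) {n : ℕ} (hn : n ≠ 0)
    (hlog : 0 < Real.log (scaleRadius lam n)) : growthScale a b lam n ≠ 0 := by
  have h1 : (scaleRadius lam n : ℂ) ≠ 0 := by exact_mod_cast (scaleRadius_pos hlam hn).ne'
  have h2 : (Real.log (scaleRadius lam n) : ℂ) ≠ 0 := by exact_mod_cast hlog.ne'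
  refine mul_ne_zero (mul_ne_zero ?_ ?_) (Complex.exp_ne_zero _)
  · exact fun h => h1 ((Complex.cpow_eq_zero_iff _ _).1 h).1
  · exact fun h => h2 ((Complex.cpow_eq_zero_iff _ _).1 h).1

theorem norm_growthScale {a b : ℂ} {lam : ℝ} (hlam : 0 < lam) {n : ℕ} (hn : n ≠ 0)
    (hlog : 0 < Real.log (scaleRadius lam n)) :
    ‖growthScale a b lam n‖ = scaleRadius lam n ^ a.re *
      Real.log (scaleRadius lam n) ^ b.re * Real.exp (n / lam) := by
  rw [growthScale, norm_mul, norm_mul, Complex.norm_cpow_eq_rpow_re_of_pos (scaleRadius_pos hlam hn),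
    Complex.norm_cpow_eq_rpow_re_of_pos hlog, Complex.norm_exp]
  congr 2
  rw [← Complex.ofReal_natCast, ← Complex.ofReal_div, Complex.ofReal_re]

/-- Principal powers split off the positive factors `r_n` and `log r_n`, so no branch correction
appears. The dependence on `ζ` is then one exponential and a factor tending to `ζ^a`. -/
theorem growth_comparison_scaled {a b : ℂ} {lam : ℝ} (hlam : 0 < lam) {n : ℕ} (hn : n ≠ 0)
    (hlog : 0 < Real.log (scaleRadius lam n)) {ζ : ℂ} (hζ : ζ ≠ 0)
    (hne : 1 + Complex.log ζ / Real.log (scaleRadius lam n) ≠ 0) :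
    ((scaleRadius lam n : ℂ) * ζ) ^ a * Complex.log ((scaleRadius lam n : ℂ) * ζ) ^ b *
        Complex.exp (((scaleRadius lam n : ℂ) * ζ) ^ (lam : ℂ)) =
      growthScale a b lam n * Complex.exp (n / lam * (ζ ^ (lam : ℂ) - 1)) *
        (ζ ^ a * (1 + Complex.log ζ / Real.log (scaleRadius lam n)) ^ b) := by
  have hr := scaleRadius_pos hlam hn
  have hl : (Real.log (scaleRadius lam n) : ℂ) ≠ 0 := by exact_mod_cast hlog.ne'
  have h1 : Complex.log ((scaleRadius lam n : ℂ) * ζ) =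
      (Real.log (scaleRadius lam n) : ℂ) *
        (1 + Complex.log ζ / Real.log (scaleRadius lam n)) := by
    rw [Complex.log_ofReal_mul hr hζ]; field_simp
  have h2 : ((scaleRadius lam n : ℂ)) ^ (lam : ℂ) = n / lam := by
    rw [← Complex.ofReal_cpow hr.le, scaleRadius_rpow hlam]; push_cast; rfl
  have h3 : Complex.exp (n / lam * ζ ^ (lam : ℂ)) =
      Complex.exp (n / lam) * Complex.exp (n / lam * (ζ ^ (lam : ℂ) - 1)) := by
    rw [← Complex.exp_add]; congr 1; ring
  rw [h1, Complex.ofReal_mul_cpow hlog hne, Complex.ofReal_mul_cpow hr hζ,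
    Complex.ofReal_mul_cpow hr hζ, h2, h3, growthScale]
  ring

theorem tendsto_one_add_div_log_cpow {ι : Type*} {l : Filter ι} {lam : ℝ} (hlam : 0 < lam)
    {N : ι → ℕ} (hN : Tendsto N l atTop) {ζ : ι → ℂ} {c : ℂ} (hζ : Tendsto ζ l (𝓝 c)) :
    Tendsto (fun i => 1 + ζ i / Real.log (scaleRadius lam (N i))) l (𝓝 1) := by
  have h1 : Tendsto (fun i => Real.log (scaleRadius lam (N i))) l atTop :=
    Real.tendsto_log_atTop.comp ((tendsto_scaleRadius hlam).comp hN)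
  have h2 : Tendsto (fun i => ((Real.log (scaleRadius lam (N i)))⁻¹ : ℝ)) l (𝓝 0) :=
    tendsto_inv_atTop_zero.comp h1
  have h3 := (Complex.continuous_ofReal.tendsto 0).comp h2
  have h4 := (hζ.mul h3).const_add 1
  simp only [Complex.ofReal_zero, mul_zero, add_zero] at h4
  refine h4.congr fun i => ?_
  simp [div_eq_mul_inv]

theorem HasSectorGrowth.tendsto_div {f : ℂ → ℂ} {a b : ℂ} {lam θ mu : ℝ} (hlam : 0 < lam)
    (hg : HasSectorGrowth f a b lam θ mu) {ι : Type*} {l : Filter ι}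
    {N : ι → ℕ} (hN : Tendsto N l atTop) {ζ : ι → ℂ} {c : ℂ} (hc : c ∈ Complex.slitPlane)
    (hζ : Tendsto ζ l (𝓝 c)) (harg : ∀ᶠ i in l, |(ζ i).arg| ≤ θ) :
    Tendsto (fun i => f ((scaleRadius lam (N i) : ℂ) * ζ i) /
      (growthScale a b lam (N i) * Complex.exp (N i / lam * (ζ i ^ (lam : ℂ) - 1))))
      l (𝓝 (c ^ a)) := by
  obtain ⟨φ, hφ, hfφ⟩ := hg.equiv_in_sector.exists_eq_mul
  have hc0 : c ≠ 0 := Complex.slitPlane_ne_zero hc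
  have hN0 : ∀ᶠ i in l, N i ≠ 0 := hN.eventually_ne_atTop 0
  have hr : Tendsto (fun i => scaleRadius lam (N i)) l atTop := (tendsto_scaleRadius hlam).comp hN
  have hlog : ∀ᶠ i in l, 0 < Real.log (scaleRadius lam (N i)) :=
    (Real.tendsto_log_atTop.comp hr).eventually_gt_atTop 0
  have hcob : Tendsto (fun i => (scaleRadius lam (N i) : ℂ) * ζ i) l
      (Bornology.cobounded ℂ ⊓ 𝓟 {z : ℂ | |z.arg| ≤ θ}) := by
    refine tendsto_inf.2 ⟨?_, tendsto_principal.2 ?_⟩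
    · rw [← tendsto_norm_atTop_iff_cobounded]
      have h := hr.atTop_mul_pos (norm_pos_iff.2 hc0) hζ.norm
      refine h.congr' ?_
      filter_upwards [hN0] with i hi
      rw [norm_mul, Complex.norm_of_nonneg (scaleRadius_pos hlam hi).le]
    · filter_upwards [hN0, harg] with i hi ha
      rw [Complex.arg_real_mul _ (scaleRadius_pos hlam hi)]
      exact ha
  have hone := tendsto_one_add_div_log_cpow hlam hN (hζ.clog hc)
  have hb := hone.cpow (tendsto_const_nhds (x := b)) Complex.one_mem_slitPlane
  have ha := hζ.cpow (tendsto_const_nhds (x := a)) hc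
  have hlim := (hφ.comp hcob).mul (ha.mul hb)
  rw [Complex.one_cpow, mul_one, one_mul] at hlim
  refine hlim.congr' ?_
  filter_upwards [hN0, hlog, hcob.eventually hfφ, hζ.eventually_ne hc0,
    hone.eventually_ne one_ne_zero] with i h1 h2 h3 h4 h5
  have hA := growthScale_ne_zero (a := a) (b := b) hlam h1 h2
  rw [h3, Pi.mul_apply, growth_comparison_scaled hlam h1 h2 h4 h5]
  have := Complex.exp_ne_zero (N i / lam * (ζ i ^ (lam : ℂ) - 1))
  simp only [Function.comp]
  field_simp

/-! ### Gaussian domination on the whole circle. -/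

/-- `1 - cos x = 2 sin²(x/2)`, and by concavity the sine lies above its chord on `[0, X/2]`. The
bound `X < 2π` keeps away from the next zero of `1 - cos`; with `X = λθ` this excludes further
saddles in the sector. -/
theorem exists_mul_sq_le_one_sub_cos {X : ℝ} (hX : 0 < X) (hX2 : X < 2 * Real.pi) :
    ∃ c > 0, ∀ x : ℝ, |x| ≤ X → c * x ^ 2 ≤ 1 - Real.cos x := by
  have hs : 0 < Real.sin (X / 2) := Real.sin_pos_of_pos_of_lt_pi (by linarith) (by linarith)
  refine ⟨2 * (Real.sin (X / 2) / X) ^ 2, by positivity, fun x hx => ?_⟩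
  have hconc := strictConcaveOn_sin_Icc.concaveOn.2
    (show (0 : ℝ) ∈ Set.Icc 0 Real.pi from ⟨le_rfl, Real.pi_pos.le⟩)
    (show X / 2 ∈ Set.Icc 0 Real.pi from ⟨by linarith, by linarith⟩)
    (show 0 ≤ 1 - |x| / X by rw [sub_nonneg, div_le_one hX]; exact hx)
    (show 0 ≤ |x| / X by positivity) (by ring)
  simp only [smul_eq_mul, Real.sin_zero, mul_zero, zero_add] at hconc
  have h1 : |x| / X * (X / 2) = |x| / 2 := by field_simp
  rw [h1] at hconc
  have h2 : Real.cos x = 1 - 2 * Real.sin (|x| / 2) ^ 2 := by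
    rw [← Real.cos_abs, show |x| = 2 * (|x| / 2) by ring, Real.cos_two_mul, Real.cos_sq']
    ring_nf
  have h3 : (|x| / X * Real.sin (X / 2)) ^ 2 ≤ Real.sin (|x| / 2) ^ 2 :=
    pow_le_pow_left₀ (by positivity) hconc 2
  have h4 : (Real.sin (X / 2) / X) ^ 2 * x ^ 2 = (|x| / X * Real.sin (X / 2)) ^ 2 := by
    rw [← sq_abs x]; ring
  rw [h2]
  nlinarith

theorem eventually_exp_le_rpow_mul_log_rpow {lam κ : ℝ} (hlam : 0 < lam) (hκ : 0 < κ) (p q : ℝ) :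
    ∀ᶠ r : ℝ in atTop, Real.exp (-κ * r ^ lam) ≤ r ^ p * Real.log r ^ q := by
  have h1 := (isLittleO_log_rpow_rpow_atTop (-q) one_pos).bound one_pos
  have h2 : Tendsto (fun r : ℝ => r ^ lam) atTop atTop := tendsto_rpow_atTop hlam
  have h3 := h2.eventually ((isLittleO_rpow_exp_pos_mul_atTop ((1 - p) / lam) hκ).bound one_pos)
  filter_upwards [h1, h3, eventually_gt_atTop 1] with r h1 h3 hr
  have hr0 : 0 < r := by linarith
  have hl : 0 < Real.log r := Real.log_pos hr
  rw [← Real.rpow_mul hr0.le, mul_div_cancel₀ _ hlam.ne', Real.norm_of_nonneg (by positivity),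
    Real.norm_of_nonneg (by positivity), one_mul] at h3
  rw [Real.norm_of_nonneg (by positivity), Real.norm_of_nonneg (by positivity), one_mul,
    Real.rpow_one] at h1
  have h4 : Real.exp (-κ * r ^ lam) ≤ (r ^ (1 - p))⁻¹ := by
    rw [neg_mul, Real.exp_neg]
    exact inv_anti₀ (by positivity) h3
  have h5 : r⁻¹ ≤ Real.log r ^ q := by
    rw [Real.rpow_neg hl.le] at h1
    exact inv_le_of_inv_le₀ (by positivity) h1
  calc _ ≤ (r ^ (1 - p))⁻¹ := h4
    _ = r ^ p * r⁻¹ := by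
      rw [← Real.rpow_neg hr0.le, neg_sub, Real.rpow_sub_one hr0.ne', div_eq_mul_inv]
    _ ≤ _ := by gcongr

theorem Complex.log_exp_ofReal_mul_I {t : ℝ} (ht : t ∈ Set.Ioc (-Real.pi) Real.pi) :
    Complex.log (Complex.exp (t * Complex.I)) = t * Complex.I :=
  Complex.log_exp (by simpa using ht.1) (by simpa using ht.2)

theorem Complex.arg_exp_ofReal_mul_I {t : ℝ} (ht : t ∈ Set.Ioc (-Real.pi) Real.pi) :
    (Complex.exp (t * Complex.I)).arg = t := by
  rw [← Complex.log_im, Complex.log_exp_ofReal_mul_I ht]; simp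

theorem Complex.exp_ofReal_mul_I_cpow {t : ℝ} (ht : t ∈ Set.Ioc (-Real.pi) Real.pi) (a : ℂ) :
    Complex.exp (t * Complex.I) ^ a = Complex.exp (t * Complex.I * a) := by
  rw [Complex.cpow_def_of_ne_zero (Complex.exp_ne_zero _), Complex.log_exp_ofReal_mul_I ht]

theorem HasSectorGrowth.exists_norm_le_in_sector {f : ℂ → ℂ} {a b : ℂ} {lam θ mu : ℝ}
    (hlam : 0 < lam) (hθ : 0 < θ) (hone : lam * θ < 2 * Real.pi)
    (hg : HasSectorGrowth f a b lam θ mu) :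
    ∃ C > 0, ∃ c > 0, ∀ᶠ n : ℕ in atTop, ∀ t ∈ Set.Ioc (-Real.pi) Real.pi, |t| ≤ θ →
      ‖f (scaleRadius lam n * Complex.exp (t * Complex.I))‖ ≤
        C * ‖growthScale a b lam n‖ * Real.exp (-c * (n * t ^ 2)) := by
  obtain ⟨φ, hφ, hfφ⟩ := hg.equiv_in_sector.exists_eq_mul
  have hev : ∀ᶠ z in Bornology.cobounded ℂ ⊓ 𝓟 {z : ℂ | |z.arg| ≤ θ},
      ‖f z‖ ≤ 2 * ‖z ^ a * Complex.log z ^ b * Complex.exp (z ^ (lam : ℂ))‖ := by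
    have h2 : ∀ᶠ z in Bornology.cobounded ℂ ⊓ 𝓟 {z : ℂ | |z.arg| ≤ θ}, ‖φ z‖ < 2 :=
      hφ.norm.eventually_lt_const (by norm_num)
    filter_upwards [h2, hfφ] with z h2 h3
    rw [h3, Pi.mul_apply, norm_mul]
    gcongr
  rw [eventually_inf_principal, ← comap_norm_atTop, eventually_comap] at hev
  have hr := tendsto_scaleRadius hlam
  obtain ⟨c, hc, hcos⟩ := exists_mul_sq_le_one_sub_cos (mul_pos hlam hθ) hone
  have hb : ∀ᶠ y : ℂ in 𝓝 1, ‖y ^ b‖ < 2 ∧ y ≠ 0 := by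
    have : Tendsto (fun y : ℂ => y ^ b) (𝓝 1) (𝓝 (1 ^ b)) :=
      (continuousAt_cpow_const Complex.one_mem_slitPlane).tendsto
    rw [Complex.one_cpow] at this
    exact (this.norm.eventually_lt_const (by norm_num)).and (eventually_ne_nhds one_ne_zero)
  obtain ⟨δ, hδ, hball⟩ := Metric.eventually_nhds_iff.1 hb
  refine ⟨4 * Real.exp (Real.pi * ‖a‖), by positivity, c * lam, by positivity, ?_⟩
  have hlogr := Real.tendsto_log_atTop.comp hr
  -- Since `|log e^{it}| ≤ π`, the threshold `π / δ` puts `1 + log ζ / log r_n` within `δ` of `1`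
  -- for all `t` at once.
  filter_upwards [hr.eventually hev, hlogr.eventually_gt_atTop (Real.pi / δ),
    eventually_ne_atTop 0] with n hn hL hn0 t ht htθ
  have hr0 := scaleRadius_pos hlam hn0
  simp only [Function.comp] at hL
  have hL0 : 0 < Real.log (scaleRadius lam n) := lt_trans (by positivity) hL
  have htpi : |t| ≤ Real.pi := abs_le.2 ⟨ht.1.le, ht.2⟩
  have he0 := Complex.exp_ne_zero (t * Complex.I)
  have hy := hball (y := 1 + Complex.log (Complex.exp (t * Complex.I)) /
      Real.log (scaleRadius lam n)) (by
    rw [Complex.log_exp_ofReal_mul_I ht, dist_eq_norm, add_sub_cancel_left, norm_div, norm_mul,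
      Complex.norm_I, mul_one, Complex.norm_real, Complex.norm_of_nonneg hL0.le, Real.norm_eq_abs,
      div_lt_iff₀ hL0]
    rw [div_lt_iff₀ hδ] at hL
    linarith)
  refine (hn _ ?_ ?_).trans ?_
  · rw [norm_mul, Complex.norm_exp_ofReal_mul_I, mul_one, Complex.norm_of_nonneg hr0.le]
  · rw [Complex.arg_real_mul _ hr0, Complex.arg_exp_ofReal_mul_I ht]
    exact htθ
  rw [growth_comparison_scaled hlam hn0 hL0 he0 hy.2, norm_mul, norm_mul, norm_mul,
    Complex.exp_ofReal_mul_I_cpow ht, Complex.exp_ofReal_mul_I_cpow ht]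
  have h1 : ‖Complex.exp (t * Complex.I * a)‖ ≤ Real.exp (Real.pi * ‖a‖) := by
    refine (Complex.norm_exp_le_exp_norm _).trans (Real.exp_le_exp.2 ?_)
    rw [norm_mul, norm_mul, Complex.norm_I, mul_one, Complex.norm_real, Real.norm_eq_abs]
    gcongr
  have h2 : ‖Complex.exp (n / lam * (Complex.exp (t * Complex.I * lam) - 1))‖ ≤
      Real.exp (-(c * lam) * (n * t ^ 2)) := by
    rw [Complex.norm_exp]
    refine Real.exp_le_exp.2 ?_
    have h3 : (n / lam * (Complex.exp (t * Complex.I * lam) - 1) : ℂ).re =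
        n / lam * (Real.cos (lam * t) - 1) := by
      rw [show (n / lam : ℂ) = ((n / lam : ℝ) : ℂ) by push_cast; rfl, Complex.re_ofReal_mul,
        show (t * Complex.I * lam : ℂ) = ((lam * t : ℝ) : ℂ) * Complex.I by push_cast; ring,
        Complex.sub_re, Complex.exp_ofReal_mul_I_re, Complex.one_re]
    rw [h3]
    have h4 := hcos (lam * t) (by rw [abs_mul, abs_of_pos hlam]; gcongr)
    calc (n / lam * (Real.cos (lam * t) - 1) : ℝ) ≤ n / lam * (-(c * (lam * t) ^ 2)) := by
          gcongr; linarith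
      _ = _ := by field_simp
  calc _ ≤ 2 * (‖growthScale a b lam n‖ * Real.exp (-(c * lam) * (n * t ^ 2)) *
        (Real.exp (Real.pi * ‖a‖) * 2)) := by
        gcongr
        exact hy.1.le
    _ = _ := by ring

theorem HasSectorGrowth.exists_norm_le_off_sector {f : ℂ → ℂ} {a b : ℂ} {lam θ mu : ℝ}
    (hlam : 0 < lam) (hmu : mu < 1) (hg : HasSectorGrowth f a b lam θ mu) :
    ∃ C > 0, ∃ c > 0, ∀ᶠ n : ℕ in atTop, ∀ t ∈ Set.Ioc (-Real.pi) Real.pi, θ < |t| →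
      ‖f (scaleRadius lam n * Complex.exp (t * Complex.I))‖ ≤
        C * ‖growthScale a b lam n‖ * Real.exp (-c * (n * t ^ 2)) := by
  obtain ⟨C, hC, hev⟩ := hg.bigO_off_sector.exists_pos
  rw [isBigOWith_iff, eventually_inf_principal, ← comap_norm_atTop, eventually_comap] at hev
  have hr := tendsto_scaleRadius hlam
  have hκ : 0 < (1 - mu) / 2 := by linarith
  -- The gap `1 - mu` is halved: one half absorbs the power and logarithm factors of `A_n`, the
  -- other pays for `exp(-c n t²)`, where `t² ≤ π²`.
  refine ⟨C, hC, (1 - mu) / 2 / (lam * Real.pi ^ 2), by positivity, ?_⟩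
  filter_upwards [hr.eventually hev,
    hr.eventually (eventually_exp_le_rpow_mul_log_rpow hlam hκ a.re b.re),
    (Real.tendsto_log_atTop.comp hr).eventually_gt_atTop 0,
    eventually_ne_atTop 0] with n hn hκn hL0 hn0 t ht htθ
  simp only [Function.comp] at hL0
  have hr0 := scaleRadius_pos hlam hn0
  have hnorm : ‖(scaleRadius lam n : ℂ) * Complex.exp (t * Complex.I)‖ = scaleRadius lam n := by
    rw [norm_mul, Complex.norm_exp_ofReal_mul_I, mul_one, Complex.norm_of_nonneg hr0.le]
  refine (hn _ hnorm ?_).trans ?_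
  · rw [Complex.arg_real_mul _ hr0, Complex.arg_exp_ofReal_mul_I ht]
    exact htθ
  rw [hnorm, scaleRadius_rpow hlam] at *
  rw [Real.norm_of_nonneg (Real.exp_nonneg _), norm_growthScale hlam hn0 hL0, mul_assoc]
  have ht2 : t ^ 2 ≤ Real.pi ^ 2 := by
    rw [← sq_abs t]
    exact pow_le_pow_left₀ (abs_nonneg t) (abs_le.2 ⟨ht.1.le, ht.2⟩) 2
  have h1 : (1 - mu) / 2 / (lam * Real.pi ^ 2) * (n * t ^ 2) ≤ (1 - mu) / 2 * (n / lam) := by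
    calc _ ≤ (1 - mu) / 2 / (lam * Real.pi ^ 2) * (n * Real.pi ^ 2) := by gcongr
      _ = _ := by have := Real.pi_ne_zero; field_simp
  refine mul_le_mul_of_nonneg_left ?_ hC.le
  calc Real.exp (mu * (n / lam)) ≤ Real.exp (-((1 - mu) / 2) * (n / lam)) * Real.exp (n / lam) *
        Real.exp (-((1 - mu) / 2 / (lam * Real.pi ^ 2)) * (n * t ^ 2)) := by
        rw [← Real.exp_add, ← Real.exp_add]
        refine Real.exp_le_exp.2 ?_
        nlinarith
    _ ≤ _ := by gcongr

theorem HasSectorGrowth.exists_norm_le_gaussian {f : ℂ → ℂ} {a b : ℂ} {lam θ mu : ℝ}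
    (hlam : 0 < lam) (hθ : 0 < θ) (hone : lam * θ < 2 * Real.pi) (hmu : mu < 1)
    (hg : HasSectorGrowth f a b lam θ mu) :
    ∃ C > 0, ∃ c > 0, ∀ᶠ n : ℕ in atTop, ∀ t ∈ Set.Ioc (-Real.pi) Real.pi,
      ‖f (scaleRadius lam n * Complex.exp (t * Complex.I))‖ ≤
        C * ‖growthScale a b lam n‖ * Real.exp (-c * (n * t ^ 2)) := by
  obtain ⟨C₁, hC₁, c₁, hc₁, h₁⟩ := hg.exists_norm_le_in_sector hlam hθ hone
  obtain ⟨C₂, hC₂, c₂, hc₂, h₂⟩ := hg.exists_norm_le_off_sector hlam hmu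
  refine ⟨max C₁ C₂, lt_max_of_lt_left hC₁, min c₁ c₂, lt_min hc₁ hc₂, ?_⟩
  filter_upwards [h₁, h₂] with n h₁ h₂ t ht
  rcases le_or_gt |t| θ with h | h
  · refine (h₁ t ht h).trans ?_
    gcongr
    exacts [le_max_left _ _, min_le_left _ _]
  · refine (h₂ t ht h).trans ?_
    gcongr
    exacts [le_max_right _ _, min_le_right _ _]

/-! ### Laplace's method at the saddle point. -/

theorem Complex.norm_exp_sub_one_sub_sub_sq_le {z : ℂ} (hz : ‖z‖ ≤ 1) :
    ‖Complex.exp z - 1 - z - z ^ 2 / 2‖ ≤ ‖z‖ ^ 3 := by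
  have h := Complex.exp_bound hz (n := 3) (by norm_num)
  simp only [Finset.sum_range_succ, Finset.sum_range_zero, pow_zero, pow_one, zero_add,
    Nat.factorial] at h
  norm_num at h
  have h0 : (0 : ℝ) ≤ ‖z‖ ^ 3 := by positivity
  calc _ = ‖Complex.exp z - (1 + z + z ^ 2 / 2)‖ := by congr 1; ring
    _ ≤ _ := h
    _ ≤ _ := by linarith

/-- With `t = u / √n`, the quadratic Taylor term of `exp(iλt)` contributes exactly `-λu²/2`, and the
cubic error is of order `n |t|³ = u² |t|`, which vanishes. -/
theorem tendsto_scaled_exp_remainder {ι : Type*} {l : Filter ι} {lam : ℝ} (hlam : 0 < lam)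
    {N : ι → ℕ} (hN : Tendsto N l atTop) (u : ℝ) :
    Tendsto (fun i => (N i / lam : ℂ) * (Complex.exp ((((√(N i))⁻¹ * u : ℝ) : ℂ) * Complex.I * lam)
      - 1 - (((√(N i))⁻¹ * u : ℝ) : ℂ) * Complex.I * lam)) l
      (𝓝 ((-(lam / 2) * u ^ 2 : ℝ) : ℂ)) := by
  have hs : Tendsto (fun i => (√(N i))⁻¹ * u) l (𝓝 0) := by
    have h := tendsto_inv_atTop_zero.comp
      (Real.tendsto_sqrt_atTop.comp (tendsto_natCast_atTop_atTop.comp hN))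
    simpa using h.mul_const u
  have habs : Tendsto (fun i => |(√(N i))⁻¹ * u| * lam) l (𝓝 0) := by
    simpa using hs.abs.mul_const lam
  have hbound : Tendsto (fun i => lam ^ 2 * u ^ 2 * |(√(N i))⁻¹ * u|) l (𝓝 0) := by
    simpa using hs.abs.const_mul (lam ^ 2 * u ^ 2)
  rw [tendsto_iff_norm_sub_tendsto_zero]
  refine squeeze_zero' (Eventually.of_forall fun _ => norm_nonneg _) ?_ hbound
  filter_upwards [habs.eventually_le_const one_pos, hN.eventually_ne_atTop 0] with i hi hi0
  set t : ℝ := (√(N i))⁻¹ * u with ht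
  have hNpos : (0 : ℝ) < N i := by exact_mod_cast Nat.pos_of_ne_zero hi0
  have ht2 : N i * t ^ 2 = u ^ 2 := by
    rw [ht, mul_pow, inv_pow, Real.sq_sqrt hNpos.le]; field_simp
  have hz : ‖(t * Complex.I * lam : ℂ)‖ = |t| * lam := by
    rw [norm_mul, norm_mul, Complex.norm_I, Complex.norm_real, Complex.norm_of_nonneg hlam.le,
      mul_one, Real.norm_eq_abs]
  have hlc : (lam : ℂ) ≠ 0 := by exact_mod_cast hlam.ne'
  have h := Complex.norm_exp_sub_one_sub_sub_sq_le (hz.trans_le hi)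
  rw [hz] at h
  have heq : ((-(lam / 2) * u ^ 2 : ℝ) : ℂ) = (N i / lam : ℂ) * ((t * Complex.I * lam) ^ 2 / 2) := by
    rw [← ht2]; push_cast
    rw [mul_pow, mul_pow, Complex.I_sq]; field_simp
  rw [heq, ← mul_sub, norm_mul]
  calc _ ≤ ‖(N i / lam : ℂ)‖ * (|t| * lam) ^ 3 := by gcongr
    _ = N i / lam * (|t| * lam) ^ 3 := by
      rw [norm_div, Complex.norm_natCast, Complex.norm_of_nonneg hlam.le]
    _ = lam ^ 2 * (N i * |t| ^ 2) * |t| := by field_simp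
    _ = _ := by rw [sq_abs, ht2]

theorem HasSectorGrowth.tendsto_saddle_pointwise {f : ℂ → ℂ} {a b : ℂ} {lam θ mu : ℝ}
    (hlam : 0 < lam) (hθ : 0 < θ) (hg : HasSectorGrowth f a b lam θ mu)
    {ι : Type*} {l : Filter ι} {N : ι → ℕ} (hN : Tendsto N l atTop) (u : ℝ) :
    Tendsto (fun i => (growthScale a b lam (N i))⁻¹ *
      (f (scaleRadius lam (N i) * Complex.exp (((√(N i))⁻¹ * u : ℝ) * Complex.I)) *
        Complex.exp (-(N i * ((√(N i))⁻¹ * u : ℝ) * Complex.I)))) l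
      (𝓝 ((Real.exp (-(lam / 2) * u ^ 2) : ℝ) : ℂ)) := by
  have hs : Tendsto (fun i => (√(N i))⁻¹ * u) l (𝓝 0) := by
    have h := tendsto_inv_atTop_zero.comp
      (Real.tendsto_sqrt_atTop.comp (tendsto_natCast_atTop_atTop.comp hN))
    simpa using h.mul_const u
  have hpi : ∀ᶠ i in l, (√(N i))⁻¹ * u ∈ Set.Ioc (-Real.pi) Real.pi :=
    hs.eventually (Ioc_mem_nhds (by linarith [Real.pi_pos]) Real.pi_pos)
  have hζ : Tendsto (fun i => Complex.exp (((√(N i))⁻¹ * u : ℝ) * Complex.I)) l (𝓝 1) := by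
    have h : Continuous fun t : ℝ => Complex.exp (t * Complex.I) := by fun_prop
    have h1 := (h.tendsto 0).comp hs
    rwa [Complex.ofReal_zero, zero_mul, Complex.exp_zero] at h1
  have harg : ∀ᶠ i in l, |(Complex.exp (((√(N i))⁻¹ * u : ℝ) * Complex.I)).arg| ≤ θ := by
    have h0 : Tendsto (fun i => |(√(N i))⁻¹ * u|) l (𝓝 0) := by simpa using hs.abs
    filter_upwards [hpi, h0.eventually_le_const hθ] with i h1 h2
    rwa [Complex.arg_exp_ofReal_mul_I h1]
  have h1 := hg.tendsto_div hlam hN Complex.one_mem_slitPlane hζ harg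
  have h2 := h1.mul (tendsto_scaled_exp_remainder hlam hN u).cexp
  rw [Complex.one_cpow, one_mul, ← Complex.ofReal_exp] at h2
  refine h2.congr' ?_
  filter_upwards [hpi] with i hi
  have hlc : (lam : ℂ) ≠ 0 := by exact_mod_cast hlam.ne'
  rw [Complex.exp_ofReal_mul_I_cpow hi]
  set t : ℝ := (√(N i))⁻¹ * u
  have h3 : Complex.exp (N i / lam * (Complex.exp (t * Complex.I * lam) - 1
      - t * Complex.I * lam)) = Complex.exp (N i / lam * (Complex.exp (t * Complex.I * lam) - 1)) *
      Complex.exp (-(N i * t * Complex.I)) := by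
    rw [← Complex.exp_add]; congr 1; field_simp; ring
  rw [h3]
  have h4 := Complex.exp_ne_zero (N i / lam * (Complex.exp (t * Complex.I * lam) - 1))
  rw [div_mul_eq_div_div, div_mul_eq_mul_div, ← mul_assoc, mul_div_assoc]
  field_simp

/-- Substituting `t = u / √n` absorbs the factor `√n`; dominated convergence under the Gaussian
bound then leaves a Gaussian integral, with the kernel frozen at `1 / (1 - ξ)`. -/
theorem HasSectorGrowth.tendsto_sqrt_mul_integral {f : ℂ → ℂ} {a b : ℂ} {lam θ mu : ℝ}
    (hlam : 0 < lam) (hθ : 0 < θ) (hone : lam * θ < 2 * Real.pi) (hmu : mu < 1)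
    (hf : Continuous f) (hg : HasSectorGrowth f a b lam θ mu)
    {ι : Type*} {l : Filter ι} [l.IsCountablyGenerated] {N : ι → ℕ} (hN : Tendsto N l atTop)
    {ζ : ι → ℂ} {ξ : ℂ} (hζ : Tendsto ζ l (𝓝 ξ)) (hξ : ‖ξ‖ < 1) :
    Tendsto (fun i => (√(N i) : ℂ) * ((growthScale a b lam (N i))⁻¹ *
      ∫ t in Set.Ioc (-Real.pi) Real.pi,
        f (scaleRadius lam (N i) * Complex.exp (t * Complex.I)) *
          Complex.exp (-(N i * t * Complex.I)) *
          (Complex.exp (t * Complex.I) / (Complex.exp (t * Complex.I) - ζ i)))) l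
      (𝓝 ((√(2 * Real.pi / lam) : ℝ) / (1 - ξ))) := by
  obtain ⟨C, hC, c, hc, hbd⟩ := hg.exists_norm_le_gaussian hlam hθ hone hmu
  let h : ι → ℝ → ℂ := fun i t => f (scaleRadius lam (N i) * Complex.exp (t * Complex.I)) *
          Complex.exp (-(N i * t * Complex.I)) *
          (Complex.exp (t * Complex.I) / (Complex.exp (t * Complex.I) - ζ i))
  let F : ι → ℝ → ℂ := fun i u => (growthScale a b lam (N i))⁻¹ *
    (Set.Ioc (-Real.pi) Real.pi).indicator (h i) ((√(N i))⁻¹ * u)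
  have hs : Tendsto (fun i => (√(N i))⁻¹) l (𝓝 0) := tendsto_inv_atTop_zero.comp
      (Real.tendsto_sqrt_atTop.comp (tendsto_natCast_atTop_atTop.comp hN))
  have hlog : ∀ᶠ i in l, 0 < Real.log (scaleRadius lam (N i)) :=
    (Real.tendsto_log_atTop.comp ((tendsto_scaleRadius hlam).comp hN)).eventually_gt_atTop 0
  have hN0 := hN.eventually_ne_atTop 0
  have key : Tendsto (fun i => ∫ u, F i u) l
      (𝓝 (∫ u : ℝ, ((Real.exp (-(lam / 2) * u ^ 2) : ℝ) : ℂ) * (1 / (1 - ξ)))) := by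
    refine MeasureTheory.tendsto_integral_filter_of_dominated_convergence
      -- The last factor bounds the kernel, because eventually `‖ζ‖ < (1 + ‖ξ‖) / 2`.
      (fun u => C * Real.exp (-c * u ^ 2) * (2 / (1 - ‖ξ‖))) ?_ ?_ ?_ ?_
    · refine Eventually.of_forall fun i => Measurable.aestronglyMeasurable ?_
      have hm : Measurable (h i) := by
        have hfm := hf.measurable
        fun_prop
      exact ((hm.indicator measurableSet_Ioc).comp (measurable_const_mul _)).const_mul _
    · filter_upwards [hN.eventually hbd, hN0, hlog,
        hζ.norm.eventually_lt_const (show ‖ξ‖ < (1 + ‖ξ‖) / 2 by linarith)] with i hi hi0 hil hiζ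
      refine Eventually.of_forall fun u => ?_
      have h1 : 0 < 1 - ‖ξ‖ := by linarith
      have hA : 0 < ‖growthScale a b lam (N i)‖ :=
        norm_pos_iff.2 (growthScale_ne_zero hlam hi0 hil)
      by_cases ht : (√(N i))⁻¹ * u ∈ Set.Ioc (-Real.pi) Real.pi
      · simp only [F, Set.indicator_of_mem ht, h]
        have hNpos : (0 : ℝ) < N i := by exact_mod_cast Nat.pos_of_ne_zero hi0
        have ht2 : N i * ((√(N i))⁻¹ * u) ^ 2 = u ^ 2 := by
          rw [mul_pow, inv_pow, Real.sq_sqrt hNpos.le]; field_simp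
        have hb := hi _ ht
        rw [ht2] at hb
        set t : ℝ := (√(N i))⁻¹ * u
        have h2 : (1 - ‖ξ‖) / 2 ≤ ‖Complex.exp (t * Complex.I) - ζ i‖ := by
          have := norm_sub_norm_le (Complex.exp (t * Complex.I)) (ζ i)
          rw [Complex.norm_exp_ofReal_mul_I] at this
          linarith
        have h3 : ‖Complex.exp (-(N i * t * Complex.I))‖ = 1 := by
          rw [show (-(N i * t * Complex.I) : ℂ) = ((-(N i * t) : ℝ) : ℂ) * Complex.I by
            push_cast; ring, Complex.norm_exp_ofReal_mul_I]
        rw [norm_mul, norm_mul, norm_mul, norm_div, h3, Complex.norm_exp_ofReal_mul_I, norm_inv,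
          mul_one]
        calc _ ≤ ‖growthScale a b lam (N i)‖⁻¹ *
              (C * ‖growthScale a b lam (N i)‖ * Real.exp (-c * u ^ 2) *
                (1 / ((1 - ‖ξ‖) / 2))) := by gcongr
          _ = _ := by field_simp
      · simp only [F, Set.indicator_of_notMem ht, mul_zero, norm_zero]
        positivity
    · exact ((integrable_exp_neg_mul_sq hc).const_mul C).mul_const _
    · refine Eventually.of_forall fun u => ?_
      have hst : Tendsto (fun i => (√(N i))⁻¹ * u) l (𝓝 0) := by simpa using hs.mul_const u
      have hpi : ∀ᶠ i in l, (√(N i))⁻¹ * u ∈ Set.Ioc (-Real.pi) Real.pi :=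
        hst.eventually (Ioc_mem_nhds (by linarith [Real.pi_pos]) Real.pi_pos)
      have hexp : Tendsto (fun i => Complex.exp (((√(N i))⁻¹ * u : ℝ) * Complex.I)) l (𝓝 1) := by
        have h : Continuous fun t : ℝ => Complex.exp (t * Complex.I) := by fun_prop
        have h1 := (h.tendsto 0).comp hst
        rwa [Complex.ofReal_zero, zero_mul, Complex.exp_zero] at h1
      have hne : (1 : ℂ) - ξ ≠ 0 := by
        intro h
        rw [← sub_eq_zero.1 h, norm_one] at hξ
        exact lt_irrefl _ hξ
      have hlim := (hg.tendsto_saddle_pointwise hlam hθ hN u).mul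
        (hexp.div (hexp.sub hζ) hne)
      refine hlim.congr' ?_
      filter_upwards [hpi] with i hi
      simp only [F, Set.indicator_of_mem hi, h, Pi.div_apply]
      ring
  have hval : ∫ u : ℝ, ((Real.exp (-(lam / 2) * u ^ 2) : ℝ) : ℂ) * (1 / (1 - ξ)) =
      (√(2 * Real.pi / lam) : ℝ) / (1 - ξ) := by
    rw [MeasureTheory.integral_mul_const, integral_complex_ofReal, integral_gaussian,
      mul_one_div, show Real.pi / (lam / 2) = 2 * Real.pi / lam by field_simp]
  rw [hval] at key
  refine key.congr fun i => ?_
  rw [MeasureTheory.integral_const_mul, MeasureTheory.Measure.integral_comp_inv_mul_left,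
    MeasureTheory.integral_indicator measurableSet_Ioc, abs_of_nonneg (Real.sqrt_nonneg _),
    Complex.real_smul]
  ring

/-! ### The limit curve and the phase function. -/

theorem AnalyticAt.sub_sub_mul_deriv_isBigO {g : ℂ → ℂ} {c : ℂ} (hg : AnalyticAt ℂ g c) :
    (fun z => g z - g c - (z - c) * deriv g c) =O[𝓝 c] fun z => (z - c) ^ 2 := by
  obtain ⟨p, hp⟩ := hg
  have hd : DifferentiableAt ℂ (dslope g c) c :=
    hp.has_fpower_series_dslope_fslope.analyticAt.differentiableAt
  have h := (isBigO_refl (fun z : ℂ => z - c) (𝓝 c)).mul hd.isBigO_sub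
  refine h.congr (fun z => ?_) fun z => (sq _).symm
  have hz : (z - c) * dslope g c z = g z - g c := by
    simpa using sub_smul_dslope g c z
  rw [mul_sub, hz, dslope_same]

theorem ne_zero_of_mem_limitCurve {lam : ℝ} (hlam : 0 < lam) {ξ : ℂ} (hξ : ξ ∈ limitCurve lam) :
    ξ ≠ 0 := by
  rintro rfl
  have h := hξ.1
  rw [Complex.zero_cpow (by exact_mod_cast hlam.ne'), zero_mul, norm_zero] at h
  exact zero_ne_one h

theorem re_eq_zero_of_mem_limitCurve {lam : ℝ} (hlam : 0 < lam) {ξ : ℂ}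
    (hξ : ξ ∈ limitCurve lam) :
    (ξ ^ (lam : ℂ) - 1 - (lam : ℂ) * Complex.log ξ).re = 0 := by
  have h := hξ.1
  rw [Complex.cpow_def_of_ne_zero (ne_zero_of_mem_limitCurve hlam hξ)] at h ⊢
  rw [← Complex.exp_add, Complex.norm_exp, Real.exp_eq_one_iff, Complex.add_re, Complex.sub_re] at h
  rw [Complex.sub_re, Complex.sub_re, mul_comm (lam : ℂ)]
  linarith

/-- On the unit circle the equation of the curve reads `cos(λ arg ξ) = 1`; since `|λ arg ξ| < 2π`,
this forces `arg ξ = 0`, hence `ξ = 1`. -/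
theorem norm_lt_one_of_mem_limitCurve {lam θ : ℝ} (hlam : 0 < lam) (hone : lam * θ < 2 * Real.pi)
    {ξ : ℂ} (hξ : ξ ∈ limitCurve lam) (harg : |ξ.arg| < θ) (hξ1 : ξ ≠ 1) : ‖ξ‖ < 1 := by
  refine lt_of_le_of_ne hξ.2 fun hn => hξ1 ?_
  have hlog : Complex.log ξ = ξ.arg * Complex.I := by
    apply Complex.ext <;> simp [Complex.log_re, Complex.log_im, hn]
  have h := re_eq_zero_of_mem_limitCurve hlam hξ
  rw [Complex.cpow_def_of_ne_zero (ne_zero_of_mem_limitCurve hlam hξ), hlog,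
    show (ξ.arg * Complex.I * lam : ℂ) = ((lam * ξ.arg : ℝ) : ℂ) * Complex.I by push_cast; ring,
    show (lam * (ξ.arg * Complex.I) : ℂ) = ((lam * ξ.arg : ℝ) : ℂ) * Complex.I by push_cast; ring,
    Complex.sub_re, Complex.sub_re, Complex.exp_ofReal_mul_I_re, Complex.re_ofReal_mul,
    Complex.I_re, Complex.one_re, mul_zero, sub_zero, sub_eq_zero] at h
  have hlt : |lam * ξ.arg| < 2 * Real.pi := by
    rw [abs_mul, abs_of_pos hlam]
    exact (mul_lt_mul_of_pos_left harg hlam).trans hone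
  rw [Real.cos_eq_one_iff_of_lt_of_lt (abs_lt.1 hlt).1 (abs_lt.1 hlt).2, mul_eq_zero] at h
  have h0 : ξ.arg = 0 := h.resolve_left hlam.ne'
  rw [← Complex.norm_mul_exp_arg_mul_I ξ, hn, h0]
  simp

theorem cpow_ne_one_of_norm_lt_one {lam : ℝ} (hlam : 0 < lam) {ξ : ℂ} (h0 : ξ ≠ 0)
    (hξ : ‖ξ‖ < 1) : ξ ^ (lam : ℂ) ≠ 1 := by
  intro h
  have h1 : ‖ξ ^ (lam : ℂ)‖ = ‖ξ‖ ^ lam := by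
    rw [Complex.norm_cpow_of_ne_zero h0]; simp
  rw [h, norm_one] at h1
  exact (Real.rpow_lt_one (norm_nonneg _) hξ hlam).ne h1.symm

/-- The logarithm of `z * exp ((1 - z ^ lam) / lam)`. -/
noncomputable def saddlePhase (lam : ℝ) (z : ℂ) : ℂ :=
  Complex.log z + (1 - z ^ (lam : ℂ)) / lam

theorem analyticAt_saddlePhase (lam : ℝ) {ξ : ℂ} (hξ : ξ ∈ Complex.slitPlane) :
    AnalyticAt ℂ (saddlePhase lam) ξ := by
  refine (analyticAt_clog hξ).add ((analyticAt_const.sub ?_).div_const)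
  exact analyticAt_id.cpow analyticAt_const hξ

theorem deriv_saddlePhase {lam : ℝ} (hlam : 0 < lam) {ξ : ℂ} (hξ : ξ ∈ Complex.slitPlane) :
    deriv (saddlePhase lam) ξ = (1 - ξ ^ (lam : ℂ)) / ξ := by
  have h0 := Complex.slitPlane_ne_zero hξ
  have hl : (lam : ℂ) ≠ 0 := by exact_mod_cast hlam.ne'
  have h1 := (hasDerivAt_id ξ).cpow_const (c := (lam : ℂ)) hξ
  have h := ((Complex.hasDerivAt_log hξ).add ((h1.const_sub 1).div_const (lam : ℂ))).deriv
  refine Eq.trans h ?_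
  rw [id, Complex.cpow_sub _ _ h0, Complex.cpow_one]
  field_simp
  ring

theorem saddlePhase_eq_of_mem_limitCurve {lam : ℝ} (hlam : 0 < lam) {ξ : ℂ}
    (hξ : ξ ∈ limitCurve lam) : saddlePhase lam ξ = -(phaseTau lam ξ / lam * Complex.I) := by
  have hl : (lam : ℂ) ≠ 0 := by exact_mod_cast hlam.ne'
  have h : ξ ^ (lam : ℂ) - 1 - (lam : ℂ) * Complex.log ξ = phaseTau lam ξ * Complex.I := by
    apply Complex.ext
    · rw [re_eq_zero_of_mem_limitCurve hlam hξ]; simp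
    · simp [phaseTau]
  rw [div_mul_eq_mul_div, ← h, saddlePhase]
  field_simp
  ring

/-- This is the role of `τ_n`: it cancels the rotation `exp(n φ(ξ))` while staying bounded in `n`.
-/
theorem exp_phaseTauSeq (lam : ℝ) (ξ : ℂ) (n : ℕ) :
    Complex.exp (n * -(phaseTau lam ξ / lam * Complex.I) + Complex.I * phaseTauSeq lam ξ n) = 1 := by
  obtain ⟨-, k, hk⟩ := (phaseTauSeq_eq_iff lam ξ n _).1 rfl
  rw [Complex.exp_eq_one_iff]
  refine ⟨-k, ?_⟩
  have h : (phaseTau lam ξ * n / lam : ℂ) = phaseTauSeq lam ξ n + k * (2 * Real.pi) := by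
    exact_mod_cast hk
  have h2 : (n * -(phaseTau lam ξ / lam * Complex.I) : ℂ) =
      -(phaseTau lam ξ * n / lam) * Complex.I := by ring
  rw [h2, h]; push_cast; ring

/-! ### Asymptotics at the points `z_n(w)`. -/

/-- The numerator of the displacement of `arcPoint` from `ξ`. -/
noncomputable def arcShift (lam : ℝ) (ξ : ℂ) (n : ℕ) (w : ℂ) : ℂ :=
  Real.log n / 2 - w + Complex.I * phaseTauSeq lam ξ n

theorem arcPoint_sub {lam : ℝ} {ξ : ℂ} (h : 1 - ξ ^ (lam : ℂ) ≠ 0) {n : ℕ} (hn : n ≠ 0) (w : ℂ) :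
    arcPoint lam ξ n w - ξ = ξ / (1 - ξ ^ (lam : ℂ)) * (arcShift lam ξ n w / n) := by
  have hnc : (n : ℂ) ≠ 0 := by exact_mod_cast hn
  rw [arcPoint, arcShift]
  field_simp
  ring

theorem norm_arcShift_le {lam : ℝ} {ξ w : ℂ} {M : ℝ} (hw : ‖w‖ ≤ M) (n : ℕ) :
    ‖arcShift lam ξ n w‖ ≤ Real.log n + (M + Real.pi) := by
  obtain ⟨⟨h1, h2⟩, -⟩ := (phaseTauSeq_eq_iff lam ξ n _).1 rfl
  have hl : 0 ≤ Real.log n := Real.log_natCast_nonneg n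
  have h3 : ‖Complex.I * (phaseTauSeq lam ξ n : ℂ)‖ ≤ Real.pi := by
    rw [norm_mul, Complex.norm_I, one_mul, Complex.norm_real]
    exact abs_le.2 ⟨h1.le, h2⟩
  have h4 : ‖(Real.log n : ℂ) / 2‖ ≤ Real.log n := by
    rw [norm_div, Complex.norm_of_nonneg hl, Complex.norm_ofNat]
    linarith
  calc _ ≤ ‖(Real.log n : ℂ) / 2‖ + ‖w‖ + ‖Complex.I * (phaseTauSeq lam ξ n : ℂ)‖ :=
        (norm_add_le _ _).trans (by gcongr; exact norm_sub_le _ _)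
    _ ≤ _ := by linarith

/-- The shift is `O(log n)` uniformly on `K`. Its square over `n` is the size of `n` times the
quadratic Taylor error of the phase. -/
theorem tendsto_arcShift_sq_div {lam : ℝ} {ξ : ℂ} {K : Set ℂ} (hK : Bornology.IsBounded K) :
    Tendsto (fun q : ℕ × ℂ => ‖arcShift lam ξ q.1 q.2‖ ^ 2 / q.1)
      ((atTop : Filter ℕ) ×ˢ 𝓟 K) (𝓝 0) := by
  obtain ⟨M, hM⟩ := hK.exists_norm_le
  have h1 : Tendsto (fun n : ℕ => (Real.log n + (M + Real.pi)) / (n : ℝ) ^ (1 / 2 : ℝ))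
      atTop (𝓝 0) := by
    have ha := (isLittleO_log_rpow_atTop (r := 1 / 2) (by norm_num)).tendsto_div_nhds_zero
    have hb := (tendsto_rpow_atTop (y := 1 / 2) (by norm_num)).const_div_atTop (M + Real.pi)
    have hc := (ha.add hb).comp tendsto_natCast_atTop_atTop
    rw [add_zero] at hc
    refine hc.congr fun n => ?_
    exact (add_div _ _ _).symm
  have h2 := (h1.pow 2).comp (tendsto_fst (f := (atTop : Filter ℕ)) (g := 𝓟 K))
  rw [zero_pow two_ne_zero] at h2
  refine squeeze_zero' (Eventually.of_forall fun _ => by positivity) ?_ h2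
  have hmem : ∀ᶠ q : ℕ × ℂ in (atTop : Filter ℕ) ×ˢ 𝓟 K, q.2 ∈ K :=
    tendsto_snd.eventually (eventually_principal.2 fun _ h => h)
  filter_upwards [hmem] with q hq
  simp only [Function.comp]
  rw [div_pow, ← Real.rpow_natCast, ← Real.rpow_natCast, ← Real.rpow_natCast,
    ← Real.rpow_mul (Nat.cast_nonneg _)]
  norm_num
  gcongr
  exact norm_arcShift_le (hM _ hq) _

theorem tendsto_arcShift_div {lam : ℝ} {ξ : ℂ} {K : Set ℂ} (hK : Bornology.IsBounded K) :
    Tendsto (fun q : ℕ × ℂ => arcShift lam ξ q.1 q.2 / q.1)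
      ((atTop : Filter ℕ) ×ˢ 𝓟 K) (𝓝 0) := by
  have h1 := tendsto_arcShift_sq_div (lam := lam) (ξ := ξ) hK
  have h2 : Tendsto (fun q : ℕ × ℂ => (q.1 : ℝ)⁻¹) ((atTop : Filter ℕ) ×ˢ 𝓟 K) (𝓝 0) :=
    (tendsto_inv_atTop_zero.comp tendsto_natCast_atTop_atTop).comp tendsto_fst
  have h3 := (h1.mul h2).sqrt
  rw [mul_zero, Real.sqrt_zero] at h3
  rw [tendsto_zero_iff_norm_tendsto_zero]
  refine h3.congr fun q => ?_
  rw [norm_div, Complex.norm_natCast, ← div_eq_mul_inv, div_div, ← sq, ← div_pow,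
    Real.sqrt_sq (by positivity)]

theorem tendsto_arcPoint {lam : ℝ} {ξ : ℂ} (h : 1 - ξ ^ (lam : ℂ) ≠ 0) {K : Set ℂ}
    (hK : Bornology.IsBounded K) :
    Tendsto (fun q : ℕ × ℂ => arcPoint lam ξ q.1 q.2) ((atTop : Filter ℕ) ×ˢ 𝓟 K) (𝓝 ξ) := by
  have h1 := ((tendsto_arcShift_div (lam := lam) (ξ := ξ) hK).const_mul
    (ξ / (1 - ξ ^ (lam : ℂ)))).const_add ξ
  rw [mul_zero, add_zero] at h1
  refine h1.congr' ?_
  filter_upwards [tendsto_fst.eventually (eventually_ne_atTop 0)] with q hq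
  rw [← arcPoint_sub h hq]; ring

/-- Up to `o(1)`, `n φ(z_n)` is `n φ(ξ) + log n / 2 - w + i τ_n`. The logarithm cancels `1/√n`, and
`τ_n` cancels `n φ(ξ)` modulo `2πi`. The prefactor `e^w` makes the limit independent of `w`. -/
theorem tendsto_arcPoint_pow_mul_exp {lam : ℝ} (hlam : 0 < lam) {ξ : ℂ}
    (hξS : ξ ∈ limitCurve lam) (hξ : ξ ∈ Complex.slitPlane) (h : 1 - ξ ^ (lam : ℂ) ≠ 0)
    {K : Set ℂ} (hK : Bornology.IsBounded K) :
    Tendsto (fun q : ℕ × ℂ => Complex.exp q.2 * (arcPoint lam ξ q.1 q.2 ^ q.1 *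
      Complex.exp (-(q.1 / lam * (arcPoint lam ξ q.1 q.2 ^ (lam : ℂ) - 1))) / (√q.1 : ℂ)))
      ((atTop : Filter ℕ) ×ˢ 𝓟 K) (𝓝 1) := by
  have hξ0 := Complex.slitPlane_ne_zero hξ
  have hl : (lam : ℂ) ≠ 0 := by exact_mod_cast hlam.ne'
  have hz := tendsto_arcPoint h hK
  have hn0 : ∀ᶠ q : ℕ × ℂ in (atTop : Filter ℕ) ×ˢ 𝓟 K, q.1 ≠ 0 :=
    tendsto_fst.eventually (eventually_ne_atTop 0)
  let R : ℂ → ℂ := fun z => saddlePhase lam z - saddlePhase lam ξ -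
    (z - ξ) * deriv (saddlePhase lam) ξ
  have hR : Tendsto (fun q : ℕ × ℂ => q.1 * R (arcPoint lam ξ q.1 q.2))
      ((atTop : Filter ℕ) ×ˢ 𝓟 K) (𝓝 0) := by
    obtain ⟨C, hC⟩ := (analyticAt_saddlePhase lam hξ).sub_sub_mul_deriv_isBigO.bound
    have h1 := (tendsto_arcShift_sq_div (lam := lam) (ξ := ξ) hK).const_mul
      (C * ‖ξ / (1 - ξ ^ (lam : ℂ))‖ ^ 2)
    rw [mul_zero] at h1
    rw [tendsto_zero_iff_norm_tendsto_zero]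
    refine squeeze_zero' (Eventually.of_forall fun _ => norm_nonneg _) ?_ h1
    filter_upwards [hz.eventually hC, hn0] with q h2 h3
    rw [norm_pow, arcPoint_sub h h3, norm_mul, norm_div (arcShift lam ξ q.1 q.2),
      Complex.norm_natCast, ← arcPoint_sub h h3] at h2
    rw [norm_mul, Complex.norm_natCast]
    have h4 : (q.1 : ℝ) ≠ 0 := by exact_mod_cast h3
    calc _ ≤ (q.1 : ℝ) * (C * (‖ξ / (1 - ξ ^ (lam : ℂ))‖ *
          (‖arcShift lam ξ q.1 q.2‖ / q.1)) ^ 2) := by gcongr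
      _ = _ := by field_simp
  have hlim := hR.cexp
  rw [Complex.exp_zero] at hlim
  refine hlim.congr' ?_
  filter_upwards [hn0, hz.eventually_ne hξ0] with q hq hq0
  have hnc : (q.1 : ℂ) ≠ 0 := by exact_mod_cast hq
  have hsq : (√q.1 : ℂ) = Complex.exp (Real.log q.1 / 2) := by
    have : (√q.1 : ℝ) = Real.exp (Real.log q.1 / 2) := by
      rw [Real.sqrt_eq_rpow, Real.rpow_def_of_pos (by exact_mod_cast Nat.pos_of_ne_zero hq)]
      congr 1; ring
    rw [this]; push_cast; rfl
  have hpow : arcPoint lam ξ q.1 q.2 ^ q.1 =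
      Complex.exp (q.1 * Complex.log (arcPoint lam ξ q.1 q.2)) := by
    rw [Complex.exp_nat_mul, Complex.exp_log hq0]
  have hlin : q.1 * ((arcPoint lam ξ q.1 q.2 - ξ) * deriv (saddlePhase lam) ξ) =
      arcShift lam ξ q.1 q.2 := by
    rw [arcPoint_sub h hq, deriv_saddlePhase hlam hξ]
    field_simp
  have hRq : q.1 * R (arcPoint lam ξ q.1 q.2) =
      (q.2 + (q.1 * Complex.log (arcPoint lam ξ q.1 q.2) +
        -(q.1 / lam * (arcPoint lam ξ q.1 q.2 ^ (lam : ℂ) - 1)) - Real.log q.1 / 2)) -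
      (q.1 * -(phaseTau lam ξ / lam * Complex.I) + Complex.I * phaseTauSeq lam ξ q.1) := by
    simp only [R]
    rw [mul_sub, hlin, saddlePhase_eq_of_mem_limitCurve hlam hξS, saddlePhase, arcShift]
    field_simp
    ring
  rw [hRq, Complex.exp_sub, exp_phaseTauSeq, div_one, Complex.exp_add, Complex.exp_sub,
    Complex.exp_add, hpow, hsq]

/-! ### Assembly of the limit. -/

theorem mainTheorem2 (f : ℂ → ℂ) (a b : ℂ) (lam θ mu : ℝ)
    (hlam : 0 < lam) (hθ : 0 < θ) (hθπ : θ < Real.pi) (hmu : mu < 1)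
    (hone : lam * θ < 2 * Real.pi)
    (hf : Differentiable ℂ f) (hgrowth : HasSectorGrowth f a b lam θ mu)
    (ξ : ℂ) (hξS : ξ ∈ limitCurve lam) (hξarg : |ξ.arg| < θ) (hξ1 : ξ ≠ 1) :
    ∀ K : Set ℂ, IsCompact K →
      TendstoUniformlyOn
        (fun (n : ℕ) (w : ℂ) =>
          maclaurinSum f (n - 1) ((scaleRadius lam n : ℂ) * arcPoint lam ξ n w) /
            f ((scaleRadius lam n : ℂ) * arcPoint lam ξ n w))
        (fun w : ℂ =>
          1 - Complex.exp (-w) /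
            (ξ ^ a * (1 - ξ) * (Real.sqrt (2 * Real.pi * lam) : ℂ)))
        atTop K := by
  intro K hK
  have hKb := hK.isBounded
  have hξ0 := ne_zero_of_mem_limitCurve hlam hξS
  have hξn := norm_lt_one_of_mem_limitCurve hlam hone hξS hξarg hξ1
  have hξs : ξ ∈ Complex.slitPlane :=
    Complex.mem_slitPlane_iff_arg.2 ⟨fun h => by
      rw [h, abs_of_pos Real.pi_pos] at hξarg
      exact lt_asymm hξarg hθπ, hξ0⟩
  have hξl : 1 - ξ ^ (lam : ℂ) ≠ 0 :=
    sub_ne_zero.2 (cpow_ne_one_of_norm_lt_one hlam hξ0 hξn).symm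
  have hN : Tendsto (Prod.fst : ℕ × ℂ → ℕ) ((atTop : Filter ℕ) ×ˢ 𝓟 K) atTop := tendsto_fst
  have hz := tendsto_arcPoint hξl hKb
  have harg : ∀ᶠ q : ℕ × ℂ in (atTop : Filter ℕ) ×ˢ 𝓟 K, |(arcPoint lam ξ q.1 q.2).arg| ≤ θ :=
    (((Complex.continuousAt_arg hξs).tendsto.comp hz).abs).eventually_le_const hξarg
  have hD := hgrowth.tendsto_div hlam hN hξs hz harg
  have hG := hgrowth.tendsto_sqrt_mul_integral hlam hθ hone hmu hf.continuous hN hz hξn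
  have hP := tendsto_arcPoint_pow_mul_exp hlam hξS hξs hξl hKb
  have hξa : ξ ^ a ≠ 0 := fun h => hξ0 ((Complex.cpow_eq_zero_iff _ _).1 h).1
  have hπ : (Real.pi : ℂ) ≠ 0 := by exact_mod_cast Real.pi_ne_zero
  have hQ := (hP.mul hG).div (hD.const_mul (2 * Real.pi : ℂ))
    (mul_ne_zero (mul_ne_zero two_ne_zero hπ) hξa)
  have hξ1' : 1 - ξ ≠ 0 := sub_ne_zero.2 hξ1.symm
  have hsqrt : (√(2 * Real.pi * lam) : ℂ) ≠ 0 := by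
    exact_mod_cast (Real.sqrt_pos.2 (by positivity)).ne'
  have hval : 1 * ((√(2 * Real.pi / lam) : ℂ) / (1 - ξ)) / (2 * Real.pi * ξ ^ a) =
      1 / (ξ ^ a * (1 - ξ) * (√(2 * Real.pi * lam) : ℂ)) := by
    have h : (√(2 * Real.pi / lam) : ℂ) * (√(2 * Real.pi * lam) : ℂ) = 2 * Real.pi := by
      rw [← Complex.ofReal_mul, ← Real.sqrt_mul (by positivity),
        show 2 * Real.pi / lam * (2 * Real.pi * lam) = (2 * Real.pi) ^ 2 by field_simp,
        Real.sqrt_sq (by positivity)]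
      push_cast; rfl
    field_simp
    exact h
  rw [hval] at hQ
  -- The factor `e^{-w}` is pulled out so that the rest is the quantity of `hQ`, which has a
  -- constant limit.
  have hratio : ∀ᶠ q : ℕ × ℂ in (atTop : Filter ℕ) ×ˢ 𝓟 K,
      maclaurinSum f (q.1 - 1) ((scaleRadius lam q.1 : ℂ) * arcPoint lam ξ q.1 q.2) /
        f ((scaleRadius lam q.1 : ℂ) * arcPoint lam ξ q.1 q.2) =
      1 - Complex.exp (-q.2) * (Complex.exp q.2 * (arcPoint lam ξ q.1 q.2 ^ q.1 *
        Complex.exp (-(q.1 / lam * (arcPoint lam ξ q.1 q.2 ^ (lam : ℂ) - 1))) / (√q.1 : ℂ)) *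
        ((√q.1 : ℂ) * ((growthScale a b lam q.1)⁻¹ *
          ∫ t in Set.Ioc (-Real.pi) Real.pi,
            f (scaleRadius lam q.1 * Complex.exp (t * Complex.I)) *
            Complex.exp (-(q.1 * t * Complex.I)) *
            (Complex.exp (t * Complex.I) /
              (Complex.exp (t * Complex.I) - arcPoint lam ξ q.1 q.2)))) /
        (2 * Real.pi * (f ((scaleRadius lam q.1 : ℂ) * arcPoint lam ξ q.1 q.2) /
          (growthScale a b lam q.1 *
            Complex.exp (q.1 / lam * (arcPoint lam ξ q.1 q.2 ^ (lam : ℂ) - 1)))))) := by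
    filter_upwards [hN.eventually_ne_atTop 0, hz.norm.eventually_lt_const hξn,
      (Real.tendsto_log_atTop.comp ((tendsto_scaleRadius hlam).comp hN)).eventually_gt_atTop 0,
      hD.eventually_ne hξa] with q hn hζ hlog hfne
    have hA := growthScale_ne_zero (a := a) (b := b) hlam hn hlog
    have hf0 : f ((scaleRadius lam q.1 : ℂ) * arcPoint lam ξ q.1 q.2) ≠ 0 :=
      fun h => hfne (by rw [h, zero_div])
    have hs : (√q.1 : ℂ) ≠ 0 := by
      exact_mod_cast (Real.sqrt_pos.2 (by exact_mod_cast Nat.pos_of_ne_zero hn)).ne'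
    have hrem := sub_maclaurinSum_eq_integral hf (scaleRadius_pos hlam hn) hζ hn
    have hsum := eq_sub_of_add_eq' (sub_eq_iff_eq_add.1 hrem).symm
    rw [hsum, sub_div, div_self hf0, Complex.exp_neg, Complex.exp_neg]
    congr 1
    have he1 := Complex.exp_ne_zero q.2
    have he2 := Complex.exp_ne_zero (q.1 / lam * (arcPoint lam ξ q.1 q.2 ^ (lam : ℂ) - 1))
    generalize (∫ t in Set.Ioc (-Real.pi) Real.pi,
      f (scaleRadius lam q.1 * Complex.exp (t * Complex.I)) *
        Complex.exp (-(q.1 * t * Complex.I)) * (Complex.exp (t * Complex.I) /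
          (Complex.exp (t * Complex.I) - arcPoint lam ξ q.1 q.2))) = J
    generalize Complex.exp (q.1 / lam * (arcPoint lam ξ q.1 q.2 ^ (lam : ℂ) - 1)) = E at he2 ⊢
    generalize f ((scaleRadius lam q.1 : ℂ) * arcPoint lam ξ q.1 q.2) = y at hf0 ⊢
    field_simp
  obtain ⟨M, hM⟩ := hKb.exists_norm_le
  rw [Metric.tendstoUniformlyOn_iff]
  intro ε hε
  -- On `K` the extracted factor satisfies `|e^{-w}| ≤ e^M`.
  have hε' : 0 < ε / Real.exp M := by positivity
  have hev := (Metric.tendsto_nhds.1 hQ _ hε').and hratio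
  rw [eventually_prod_principal_iff] at hev
  filter_upwards [hev] with n hn w hw
  obtain ⟨h1, h2⟩ := hn w hw
  rw [h2, dist_comm, dist_eq_norm, ← mul_one_div (Complex.exp (-w)), sub_sub_sub_cancel_left,
    ← mul_sub, norm_mul]
  rw [dist_comm, dist_eq_norm] at h1
  have h3 : ‖Complex.exp (-w)‖ ≤ Real.exp M :=
    (Complex.norm_exp_le_exp_norm _).trans (Real.exp_le_exp.2 (by rw [norm_neg]; exact hM w hw))
  calc _ ≤ Real.exp M * _ := mul_le_mul_of_nonneg_right h3 (norm_nonneg _)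
    _ < Real.exp M * (ε / Real.exp M) := mul_lt_mul_of_pos_left h1 (Real.exp_pos M)
    _ = ε := by field_simp
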